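/- All graphs are finite and simple. A labeling of a digraph $D$ with $m$ arcs is a bijection from its set of arcs to $\{1,\dots,m\}$; the vertex-sum of a vertex $u$ is the sum of the labels of the arcs entering $u$ minus the sum of the labels of the arcs leaving $u$; $D$ is antimagic if it has a labeling for which no two distinct vertices have the same vertex-sum. An antimagic orientation of a graph $G$ is an orientation of $G$ that is an antimagic digraph. A component is odd if its number of vertices is odd. **Theorem.** Let $d\ge 2$ be an integer and let $G$ be a $2d$-regular graph whose odd components are $G_1,\dots,G_k$ with $|G_1|\le |G_2|\le\dots\le|G_k|$ (the number of even components is arbitrary). Then: (1) If $0\le k\le 5d+4$, then $G$ has an antimagic orientation. (2) If $k\ge 5d+5$, then there is a unique positive integer $x_0$ that solves one of the $2d-2$ equations $$k=(2d-2)x+(3d+7),\quad k=(2d-2)x+(3d+8),\quad\dots,\quad k=(2d-2)x+(5d+4),$$ and if $|G_1|\ge 2x_0+5$ for this $x_0$, then $G$ has an antimagic orientation. -/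

import Mathlib

open scoped Classical in
/-- The vertex-sum of `u` for the labels `c` of the arcs of `D`: the sum of the labels of the arcs
entering `u` minus the sum of the labels of the arcs leaving `u` (an integer). -/
noncomputable def Digraph.vertexSum {V : Type*} [Fintype V] (D : Digraph V) (c : V × V → ℕ)
    (u : V) : ℤ :=
  (∑ v : V with D.Adj v u, (c (v, u) : ℤ)) - ∑ v : V with D.Adj u v, (c (u, v) : ℤ)

/-- The set `A(D)` of arcs of a digraph, an arc from `u` to `v` being the pair `(u, v)`. -/
def Digraph.arcSet {V : Type*} (D : Digraph V) : Set (V × V) :=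
  {a | D.Adj a.1 a.2}

/-- `c` is a labeling of `D`: it restricts to a bijection from the set of arcs of `D` onto
`{1, …, m}`, where `m` is the number of arcs. (Values outside the arcs play no role.) -/
def Digraph.IsLabeling {V : Type*} (D : Digraph V) (c : V × V → ℕ) : Prop :=
  Set.BijOn c D.arcSet (Set.Icc 1 D.arcSet.ncard)

/-- A digraph is antimagic if it has a labeling for which distinct vertices have distinct
vertex-sums. -/
def Digraph.IsAntimagic {V : Type*} [Fintype V] (D : Digraph V) : Prop :=
  ∃ c : V × V → ℕ, D.IsLabeling c ∧ ∀ u v : V, u ≠ v → D.vertexSum c u ≠ D.vertexSum c v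

/-- `D` is an orientation of the simple graph `G`: every edge of `G` receives exactly one of its
two directions, and `D` has no other arcs. -/
def SimpleGraph.IsOrientation {V : Type*} (G : SimpleGraph V) (D : Digraph V) : Prop :=
  (∀ u v : V, G.Adj u v ↔ D.Adj u v ∨ D.Adj v u) ∧ ∀ u v : V, ¬ (D.Adj u v ∧ D.Adj v u)

/-- `G` has an antimagic orientation. -/
def SimpleGraph.HasAntimagicOrientation {V : Type*} [Fintype V] (G : SimpleGraph V) : Prop :=
  ∃ D : Digraph V, G.IsOrientation D ∧ D.IsAntimagic

/-- `x` is a positive integer that solves one of the equations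
`k = (2d - 2) x + c`, where `c = 3d + 7, 3d + 8, …, 5d + 4`. -/
def IsOrderParameter (d k x : ℕ) : Prop :=
  0 < x ∧ ∃ c ∈ Finset.Icc (3 * d + 7) (5 * d + 4), k = (2 * d - 2) * x + c

/-!
Every `2d`-regular graph with `d ≥ 2` has an antimagic orientation, whatever its components are;
both parts of the theorem follow.

Run along an Euler circuit of each component. Cut the circuit at one visit to each vertex, direct
the resulting pieces alternately against and along the circuit, and let the labels increase by one
from arc to arc along each directed piece. A visit at which the circuit is not cut contributes `-1`
to the vertex-sum. At a cut, both edges enter the vertex (a sink) or both leave it (a source), and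
the two labels at the cut are added or subtracted. So, with `d` visits to each vertex, the
vertex-sums are `-(d - 1) + P` at sinks and `-(d - 1) - P` at sources, `P` being the sum of the two
labels at the cut; sinks are separated from sources, and it remains to have `P` injective on each.
If the pieces of one circuit are labeled in the zigzag order `0, 2r - 1, 1, 2r - 2, …`, and the
circuits one after another, then of two pairs of labels at sinks one dominates the other
(`zigzag_dominates`), and the same holds for sources.

The alternation needs an even number of cuts, so an odd component must be cut twice at one vertex
`z`, which must be a sink both times. Since `d ≥ 2`, the circuit has a closed part, from `z` to `z`
and of minimal length, that is not all of it. All its inner vertices are visited elsewhere too, and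
so one may cut it just at its first inner vertex `w`, and cut the rest of the circuit at all
vertices but `w`. The two pieces of the closed part, both directed from `w` to `z`, get labels
above those of all other pieces of the graph, again one component after another. This puts the
vertex-sum of `w` below those of the ordinary sources and the vertex-sum of `z`, where four labels
are added, above those of the ordinary sinks.
-/

open scoped Finset

/-! ### Euler circuits -/

namespace SimpleGraph

variable {V : Type*} {G : SimpleGraph V}

theorem Walk.IsTrail.exists_adj_notMem_edges [Fintype V] [DecidableRel G.Adj] {a b : V}
    {p : G.Walk a b} (hp : p.IsTrail) (hab : a ≠ b) (hb : Even (G.degree b)) :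
    ∃ c, G.Adj b c ∧ s(b, c) ∉ p.edges := by
  classical
  by_contra! h
  have hodd : ¬ Even (p.edges.countP fun e => b ∈ e) := by
    rw [hp.even_countP_edges_iff b]
    exact fun h' => (h' hab).2 rfl
  apply hodd
  convert hb using 1
  rw [← G.card_incidenceFinset_eq_degree, List.countP_eq_length_filter,
    ← List.toFinset_card_of_nodup (hp.edges_nodup.filter _)]
  congr 1
  ext e
  induction e with | _ x y =>
  simp only [List.mem_toFinset, List.mem_filter, decide_eq_true_eq, mem_incidenceFinset,
    incidenceSet, Set.mem_ofPred_eq, Sym2.mem_iff]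
  constructor
  · rintro ⟨h1, h2⟩
    exact ⟨p.adj_of_mem_edges h1, h2⟩
  · rintro ⟨h1, rfl | rfl⟩
    · exact ⟨h _ h1, Or.inl rfl⟩
    · exact ⟨Sym2.eq_swap ▸ h _ h1.symm, Or.inr rfl⟩

/-- Euler's theorem, for the component of `v`: a longest trail in the component is closed, by
parity, and it misses no edge at any of its vertices, since otherwise it could be rotated and
extended. -/
theorem exists_closed_trail_covering_component [Fintype V] [DecidableRel G.Adj]
    (hG : ∀ v, Even (G.degree v)) (v : V) :
    ∃ (a : V) (p : G.Walk a a), G.Reachable v a ∧ p.IsTrail ∧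
      ∀ x y, G.Reachable v x → G.Adj x y → s(x, y) ∈ p.edges := by
  classical
  let P : ℕ → Prop := fun n => ∃ (a b : V) (p : G.Walk a b), G.Reachable v a ∧ p.IsTrail ∧
    p.length = n
  have hP0 : P 0 := ⟨v, v, Walk.nil, Reachable.refl v, Walk.IsTrail.nil, rfl⟩
  have hbd : ∀ n, P n → n ≤ G.edgeFinset.card := by
    rintro n ⟨a, b, p, -, hp, rfl⟩
    exact hp.length_le_card_edgeFinset
  obtain ⟨a, b, p, hva, hp, hlen⟩ := Nat.findGreatest_spec (P := P) (Nat.zero_le _) hP0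
  have hmax : ∀ n, P n → n ≤ p.length := fun n hn =>
    hlen ▸ Nat.le_findGreatest (hbd n hn) hn
  have hext : ∀ {a b c : V} (q : G.Walk a b), G.Reachable v a → q.IsTrail →
      q.length = p.length → G.Adj b c → s(b, c) ∈ q.edges := by
    intro a b c q hva hq hql hbc
    by_contra hnot
    have h1 : (q.concat hbc).IsTrail := by
      rw [Walk.isTrail_def, Walk.edges_concat, List.concat_eq_append, List.nodup_append_comm]
      exact List.nodup_cons.2 ⟨hnot, hq.edges_nodup⟩
    have h2 := hmax _ ⟨a, c, q.concat hbc, hva, h1, rfl⟩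
    rw [Walk.length_concat] at h2
    omega
  have hab : a = b := by
    by_contra hab
    obtain ⟨c, hbc, hc⟩ := hp.exists_adj_notMem_edges hab (hG b)
    exact hc (hext p hva hp rfl hbc)
  subst hab
  have hsupp : ∀ x y, x ∈ p.support → G.Adj x y → s(x, y) ∈ p.edges := by
    intro x y hx hxy
    have hvx : G.Reachable v x := hva.trans ⟨p.takeUntil x hx⟩
    have := hext (p.rotate x hx) hvx ((Walk.isTrail_rotate hx).2 hp) (Walk.length_rotate ..) hxy
    exact (p.rotate_edges x hx).mem_iff.1 this
  have hreach : ∀ {x y : V}, G.Walk x y → x ∈ p.support → y ∈ p.support := by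
    intro x y w
    induction w with
    | nil => exact id
    | cons h _ ih => exact fun hx => ih (p.snd_mem_support_of_mem_edges (hsupp _ _ hx h))
  refine ⟨a, p, hva, hp, fun x y hx hxy => hsupp x y ?_ hxy⟩
  obtain ⟨w⟩ := hva.symm.trans hx
  exact hreach w p.start_mem_support

/-- `f : ℕ → V` runs periodically, with period `L`, along an Euler circuit of the component `C`: the
`i`-th edge of the circuit is `s(f i, f (i + 1))`. -/
structure IsEulerSeq (G : SimpleGraph V) (C : G.ConnectedComponent) (L : ℕ) (f : ℕ → V) :
    Prop where
  pos : 0 < L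
  periodic : ∀ i, f (i + L) = f i
  mem : ∀ i, G.connectedComponentMk (f i) = C
  adj : ∀ i, G.Adj (f i) (f (i + 1))
  inj : ∀ i j, s(f i, f (i + 1)) = s(f j, f (j + 1)) → i ≡ j [MOD L]
  cover : ∀ x y, G.Adj x y → G.connectedComponentMk x = C → ∃ i, s(f i, f (i + 1)) = s(x, y)

theorem exists_isEulerSeq [Fintype V] [DecidableRel G.Adj] (hG : ∀ v, Even (G.degree v))
    (hpos : ∀ v, 0 < G.degree v) (C : G.ConnectedComponent) : ∃ L f, G.IsEulerSeq C L f := by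
  induction C using ConnectedComponent.ind with | _ v =>
  obtain ⟨a, p, hva, hp, hcov⟩ := G.exists_closed_trail_covering_component hG v
  have hlen : p.edges.length = p.length := p.length_edges
  have hL : 0 < p.length := by
    obtain ⟨w, hw⟩ := (G.degree_pos_iff_exists_adj v).1 (hpos v)
    rw [← hlen]
    exact List.length_pos_of_mem (hcov v w (Reachable.refl v) hw)
  have hmod : ∀ i, p.getVert ((i + 1) % p.length) = p.getVert (i % p.length + 1) := by
    intro i
    rw [← Nat.mod_add_mod]
    rcases Nat.lt_or_ge (i % p.length + 1) p.length with h | h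
    · rw [Nat.mod_eq_of_lt h]
    · have h' : i % p.length + 1 = p.length := le_antisymm (Nat.mod_lt i hL) h
      rw [h', Nat.mod_self, p.getVert_zero, p.getVert_length]
  have hedge : ∀ i (hi : i % p.length < p.edges.length),
      s(p.getVert (i % p.length), p.getVert ((i + 1) % p.length)) = p.edges[i % p.length] := by
    intro i hi
    rw [hmod, Walk.getElem_edges]
  have hlt : ∀ i, i % p.length < p.edges.length := fun i => hlen.symm ▸ Nat.mod_lt i hL
  refine ⟨p.length, fun i => p.getVert (i % p.length), hL, ?_, ?_, ?_, ?_, ?_⟩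
  · intro i
    simp
  · intro i
    rw [ConnectedComponent.eq]
    exact (hva.trans ⟨p.take _⟩).symm
  · intro i
    rw [hmod]
    exact p.adj_getVert_succ (Nat.mod_lt i hL)
  · intro i j hij
    rw [hedge i (hlt i), hedge j (hlt j)] at hij
    exact (hp.edges_nodup.getElem_inj_iff).1 hij
  · intro x y hxy hx
    obtain ⟨i, hi, h⟩ := List.mem_iff_getElem.1 (hcov x y (ConnectedComponent.eq.1 hx).symm hxy)
    have him : i % p.length = i := Nat.mod_eq_of_lt (hlen ▸ hi)
    refine ⟨i, ?_⟩
    rw [hedge i (hlt i), ← h]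
    simp only [him]

namespace IsEulerSeq

variable {C : G.ConnectedComponent} {L : ℕ} {f : ℕ → V}

theorem shift (h : G.IsEulerSeq C L f) (k : ℕ) : G.IsEulerSeq C L fun i => f (i + k) where
  pos := h.pos
  periodic i := by rw [add_right_comm, h.periodic]
  mem i := h.mem _
  adj i := by rw [add_right_comm]; exact h.adj _
  inj i j hij := by
    simp only [add_right_comm _ 1 k] at hij
    exact Nat.ModEq.add_right_cancel' k (h.inj _ _ hij)
  cover x y hxy hx := by
    obtain ⟨i, hi⟩ := h.cover x y hxy hx
    have hper : ∀ m j, f (j + m * L) = f j := by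
      intro m
      induction m with
      | zero => simp
      | succ m ih => intro j; rw [Nat.succ_mul, ← add_assoc, h.periodic, ih]
    refine ⟨i + k * L - k, ?_⟩
    have hk : k ≤ k * L := Nat.le_mul_of_pos_right k h.pos
    have e1 : i + k * L - k + k = i + k * L := by omega
    have e2 : i + k * L - k + 1 + k = i + 1 + k * L := by omega
    simp only [e1, e2, hper, hi]

theorem exists_lt (h : G.IsEulerSeq C L f) {x y : V} (hxy : G.Adj x y)
    (hx : G.connectedComponentMk x = C) : ∃ i < L, s(f i, f (i + 1)) = s(x, y) := by
  obtain ⟨i, hi⟩ := h.cover x y hxy hx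
  have hmod : ∀ j, f (j % L) = f j := (show Function.Periodic f L from h.periodic).map_mod_nat
  refine ⟨i % L, Nat.mod_lt _ h.pos, ?_⟩
  rw [hmod, ← hmod (i % L + 1), Nat.mod_add_mod, hmod, hi]

theorem eq_of_lt (h : G.IsEulerSeq C L f) {i j : ℕ} (hi : i < L) (hj : j < L)
    (hij : s(f i, f (i + 1)) = s(f j, f (j + 1))) : i = j :=
  Nat.ModEq.eq_of_lt_of_lt (h.inj _ _ hij) hi hj

/-- Summing over the circuit, the end of an edge may be traded for the beginning of the next. -/
theorem sum_shift {M : Type*} [AddCommGroup M] (h : G.IsEulerSeq C L f) (P : V → Prop)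
    [DecidablePred P] (x : ℕ → M) :
    (∑ i ∈ Finset.range L with P (f (i + 1)), x i) =
      ∑ i ∈ Finset.range L with P (f i), x (if i = 0 then L - 1 else i - 1) := by
  obtain ⟨n, rfl⟩ : ∃ n, L = n + 1 := ⟨L - 1, by have := h.pos; omega⟩
  rw [Finset.sum_filter, Finset.sum_filter, Finset.sum_range_succ, Finset.sum_range_succ']
  have h0 : f (n + 1) = f 0 := by simpa using h.periodic 0
  simp [h0]

/-- Each vertex of a `2d`-regular component is visited `d` times. -/
theorem card_visits [DecidableEq V] [Fintype V] [DecidableRel G.Adj] (h : G.IsEulerSeq C L f)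
    {d : ℕ} {v : V} (hv : G.connectedComponentMk v = C) (hd : G.degree v = 2 * d) :
    #{i ∈ Finset.range L | f i = v} = d := by
  have hA : #{i ∈ Finset.range L | f (i + 1) = v} = #{i ∈ Finset.range L | f i = v} := by
    have := h.sum_shift (M := ℤ) (· = v) (fun _ => 1)
    simpa using this
  have hN : G.neighborFinset v =
      Finset.image (fun i => f (i + 1)) {i ∈ Finset.range L | f i = v} ∪
        Finset.image f {i ∈ Finset.range L | f (i + 1) = v} := by
    ext w
    simp only [mem_neighborFinset, Finset.mem_union, Finset.mem_image, Finset.mem_filter,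
      Finset.mem_range]
    constructor
    · intro hvw
      obtain ⟨i, hi, he⟩ := h.exists_lt hvw hv
      rcases Sym2.eq_iff.1 he with ⟨h1, h2⟩ | ⟨h1, h2⟩
      · exact Or.inl ⟨i, ⟨hi, h1⟩, h2⟩
      · exact Or.inr ⟨i, ⟨hi, h2⟩, h1⟩
    · rintro (⟨i, ⟨hi, rfl⟩, rfl⟩ | ⟨i, ⟨hi, rfl⟩, rfl⟩)
      · exact h.adj i
      · exact (h.adj i).symm
  have hdisj : Disjoint (Finset.image (fun i => f (i + 1)) {i ∈ Finset.range L | f i = v})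
        (Finset.image f {i ∈ Finset.range L | f (i + 1) = v}) := by
    rw [Finset.disjoint_left]
    simp only [Finset.mem_image, Finset.mem_filter, Finset.mem_range]
    rintro w ⟨i, ⟨hi, h1⟩, h2⟩ ⟨j, ⟨hj, h3⟩, h4⟩
    have := h.eq_of_lt hi hj (by rw [h1, h2, h3, h4, Sym2.eq_swap])
    subst this
    have := h.adj i
    rw [h1, h3] at this
    exact this.ne rfl
  rw [← card_neighborFinset_eq_degree, hN, Finset.card_union_of_disjoint hdisj,
    Finset.card_image_of_injOn, Finset.card_image_of_injOn, hA] at hd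
  · omega
  · intro i hi j hj hij
    simp only [Finset.coe_filter, Finset.mem_range, Set.mem_ofPred_eq] at hi hj
    exact h.eq_of_lt hi.1 hj.1 (by rw [hi.2, hj.2, hij])
  · intro i hi j hj hij
    simp only [Finset.coe_filter, Finset.mem_range, Set.mem_ofPred_eq] at hi hj
    simp only at hij
    exact h.eq_of_lt hi.1 hj.1 (by rw [hi.2, hj.2, hij])

end IsEulerSeq

end SimpleGraph

/-! ### Ranks, and orientations given by an enumeration of the edges -/

namespace Finset

variable {α β : Type*} [LinearOrder β] {S : Finset α} {key : α → β}

/-- The rank of `a` in `S` (counting from `1`) when the elements of `S` are sorted by `key`. -/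
def rankBy (S : Finset α) (key : α → β) (a : α) : ℕ :=
  #{b ∈ S | key b ≤ key a}

theorem rankBy_pos {a : α} (ha : a ∈ S) : 0 < S.rankBy key a :=
  card_pos.2 ⟨a, by simpa using ha⟩

theorem rankBy_lt_rankBy {a b : α} (hb : b ∈ S) (h : key a < key b) :
    S.rankBy key a < S.rankBy key b := by
  refine card_lt_card (ssubset_iff_of_subset ?_ |>.2 ⟨b, ?_, ?_⟩)
  · exact monotone_filter_right S fun c _ hc => hc.trans h.le
  · simp [hb]
  · simp [h]

theorem rankBy_eq_rankBy_add_one (hkey : Set.InjOn key S) {a b : α} (hb : b ∈ S)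
    (h : key a < key b) (hab : ∀ c, key a < key c → ¬ key c < key b) :
    S.rankBy key b = S.rankBy key a + 1 := by
  classical
  have : {c ∈ S | key c ≤ key b} = insert b {c ∈ S | key c ≤ key a} := by
    ext c
    simp only [mem_filter, mem_insert]
    constructor
    · rintro ⟨hc, hcb⟩
      rcases hcb.eq_or_lt with hcb | hcb
      · exact Or.inl (hkey hc hb hcb)
      · exact Or.inr ⟨hc, not_lt.1 fun hac => hab c hac hcb⟩
    · rintro (rfl | ⟨hc, hca⟩)
      · exact ⟨hb, le_rfl⟩
      · exact ⟨hc, hca.trans h.le⟩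
  rw [rankBy, this, card_insert_of_notMem (by simp [h]), rankBy]

theorem bijOn_rankBy (hkey : Set.InjOn key S) :
    Set.BijOn (S.rankBy key) S (Set.Icc 1 #S) := by
  have hmaps : Set.MapsTo (S.rankBy key) S (Icc 1 #S : Finset ℕ) := by
    intro a ha
    rw [coe_Icc]
    exact ⟨rankBy_pos ha, card_filter_le _ _⟩
  have hinj : Set.InjOn (S.rankBy key) S := by
    intro a ha b hb hab
    rcases lt_trichotomy (key a) (key b) with h | h | h
    · exact absurd hab (rankBy_lt_rankBy hb h).ne
    · exact hkey ha hb h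
    · exact absurd hab (rankBy_lt_rankBy ha h).ne'
  have := (surjOn_of_injOn_of_card_le _ hmaps hinj (by simp))
  rw [← coe_Icc]
  exact ⟨hmaps, hinj, this⟩

end Finset

namespace SimpleGraph

/-- An antimagic orientation may be presented by a finite set `S` of names of edges: `s ∈ S` names
the arc from `src s` to `dst s`, and has the label `lab s`. -/
theorem hasAntimagicOrientation_of_enumeration {V α : Type*} [Fintype V] [DecidableEq V]
    {G : SimpleGraph V} {S : Finset α} {src dst : α → V} {lab : α → ℕ}
    (hadj : ∀ s ∈ S, G.Adj (src s) (dst s))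
    (hinj : ∀ s ∈ S, ∀ t ∈ S, s(src s, dst s) = s(src t, dst t) → s = t)
    (hcover : ∀ u v, G.Adj u v → ∃ s ∈ S, s(src s, dst s) = s(u, v))
    (hlab : Set.BijOn lab S (Set.Icc 1 #S))
    (hsum : Function.Injective fun u => (∑ s ∈ S with dst s = u, (lab s : ℤ)) -
      ∑ s ∈ S with src s = u, (lab s : ℤ)) :
    G.HasAntimagicOrientation := by
  classical
  let D : Digraph V := ⟨fun u v => ∃ s ∈ S, src s = u ∧ dst s = v⟩
  have harcinj : Set.InjOn (fun s => (src s, dst s)) S := by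
    intro s hs t ht hst
    simp only [Prod.mk.injEq] at hst
    exact hinj s hs t ht (by rw [hst.1, hst.2])
  have harc : Set.BijOn (fun s => (src s, dst s)) S D.arcSet := by
    refine ⟨fun s hs => ⟨s, hs, rfl, rfl⟩, harcinj, ?_⟩
    rintro ⟨u, v⟩ ⟨s, hs, rfl, rfl⟩
    exact ⟨s, hs, rfl⟩
  have hcard : D.arcSet.ncard = #S := by
    rw [← harc.image_eq, harcinj.ncard_image, Set.ncard_coe_finset]
  let c : V × V → ℕ := fun p => if h : ∃ s ∈ S, (src s, dst s) = p then lab h.choose else 0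
  have hc : ∀ s ∈ S, c (src s, dst s) = lab s := by
    intro s hs
    have h : ∃ t ∈ S, (src t, dst t) = (src s, dst s) := ⟨s, hs, rfl⟩
    simp only [c, dif_pos h]
    rw [harcinj h.choose_spec.1 hs h.choose_spec.2]
  refine ⟨D, ⟨fun u v => ⟨fun huv => ?_, ?_⟩, ?_⟩, c, ?_, fun u v huv heq => huv (hsum ?_)⟩
  · obtain ⟨s, hs, he⟩ := hcover u v huv
    rcases Sym2.eq_iff.1 he with ⟨h1, h2⟩ | ⟨h1, h2⟩
    · exact Or.inl ⟨s, hs, h1, h2⟩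
    · exact Or.inr ⟨s, hs, h1, h2⟩
  · rintro (⟨s, hs, rfl, rfl⟩ | ⟨s, hs, rfl, rfl⟩)
    · exact hadj s hs
    · exact (hadj s hs).symm
  · rintro u v ⟨⟨s, hs, rfl, rfl⟩, t, ht, h1, h2⟩
    have := hinj s hs t ht (by rw [h1, h2, Sym2.eq_swap])
    subst this
    exact (hadj s hs).ne h1
  · rw [Digraph.IsLabeling, hcard]
    have hcomp : Set.BijOn (c ∘ fun s => (src s, dst s)) S (Set.Icc 1 #S) :=
      hlab.congr fun s hs => (hc s hs).symm
    rw [← harc.image_eq]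
    exact ⟨Set.mapsTo_image_iff.2 hcomp.mapsTo, hcomp.injOn.image_of_comp,
      by rw [Set.SurjOn, ← Set.image_comp]; exact hcomp.surjOn⟩
  · have key : ∀ u, D.vertexSum c u = (∑ s ∈ S with dst s = u, (lab s : ℤ)) -
        ∑ s ∈ S with src s = u, (lab s : ℤ) := by
      intro u
      rw [Digraph.vertexSum]
      congr 1
      · symm
        refine Finset.sum_bij (fun s _ => src s) ?_ ?_ ?_ ?_
        · simp only [Finset.mem_filter]
          rintro s ⟨hs, rfl⟩
          exact ⟨Finset.mem_univ _, s, hs, rfl, rfl⟩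
        · simp only [Finset.mem_filter]
          rintro s ⟨hs, h1⟩ t ⟨ht, h2⟩ hst
          exact harcinj hs ht (by simp only [hst, h1, h2])
        · simp only [Finset.mem_filter]
          rintro v ⟨-, s, hs, rfl, rfl⟩
          exact ⟨s, ⟨hs, rfl⟩, rfl⟩
        · simp only [Finset.mem_filter]
          rintro s ⟨hs, rfl⟩
          rw [hc s hs]
      · symm
        refine Finset.sum_bij (fun s _ => dst s) ?_ ?_ ?_ ?_
        · simp only [Finset.mem_filter]
          rintro s ⟨hs, rfl⟩
          exact ⟨Finset.mem_univ _, s, hs, rfl, rfl⟩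
        · simp only [Finset.mem_filter]
          rintro s ⟨hs, h1⟩ t ⟨ht, h2⟩ hst
          exact harcinj hs ht (by simp only [hst, h1, h2])
        · simp only [Finset.mem_filter]
          rintro v ⟨-, s, hs, rfl, rfl⟩
          exact ⟨s, ⟨hs, rfl⟩, rfl⟩
        · simp only [Finset.mem_filter]
          rintro s ⟨hs, rfl⟩
          rw [hc s hs]
    simpa only [key] using heq

end SimpleGraph

/-! ### Cutting an Euler circuit -/

namespace SimpleGraph

variable {V : Type*} {G : SimpleGraph V} {C : G.ConnectedComponent} {M L : ℕ} {f : ℕ → V}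

/-- The circuit `f` is cut at time `i` of its main part, which consists of the times `0, …, M - 1`:
these are the times of the first visits to the vertices. If `M < L`, the times `M, …, L` form the
closed part that belongs to an odd component; it is cut at `f (M + 1)`, which therefore is left out
here. -/
def IsMainCut (M L : ℕ) (f : ℕ → V) (i : ℕ) : Prop :=
  i < M ∧ (∀ j < i, f j ≠ f i) ∧ (M < L → f i ≠ f (M + 1))

open scoped Classical in
/-- The number of the piece of the main part that contains the `i`-th edge, for `i < M`: it counts
the cuts at the times `1, …, i`, so that the piece which begins with the cut at time `0` is the
`0`-th. -/
noncomputable def piece (M L : ℕ) (f : ℕ → V) (i : ℕ) : ℕ :=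
  Nat.count (fun j => IsMainCut M L f (j + 1)) i

/-- An Euler circuit of length `L`, split into a main part (the times before `M`), which the cuts
divide into an even number of pieces, and a second closed part from `f M` to `f L = f M`. The second
part is empty (`M = L`) for even components. Otherwise it is to be cut at its ends and at
`f (M + 1)`, into two pieces of positive length. -/
structure IsSplitCircuit (G : SimpleGraph V) (C : G.ConnectedComponent) (M L : ℕ) (f : ℕ → V) :
    Prop extends G.IsEulerSeq C L f where
  main_pos : 0 < M
  main_le : M ≤ L
  apply_main : M < L → f M = f 0
  lt_of_lt : M < L → M + 1 < L
  exists_visit : ∀ v, G.connectedComponentMk v = C → ∃ i < M, f i = v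
  odd_piece : Odd (piece M L f (M - 1))

theorem IsMainCut.eq {i j : ℕ} (hi : IsMainCut M L f i) (hj : IsMainCut M L f j)
    (h : f i = f j) : i = j := by
  rcases lt_trichotomy i j with hij | hij | hij
  · exact absurd h (hj.2.1 i hij)
  · exact hij
  · exact absurd h.symm (hi.2.1 j hij)

theorem exists_isMainCut {i : ℕ} (hi : i < M) (h : M < L → f i ≠ f (M + 1)) :
    ∃ j, IsMainCut M L f j ∧ f j = f i := by
  classical
  have hex : ∃ j, f j = f i := ⟨i, rfl⟩
  refine ⟨Nat.find hex, ⟨(Nat.find_le (h := hex) rfl).trans_lt hi, fun j hj => ?_, ?_⟩,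
    Nat.find_spec hex⟩
  · rw [Nat.find_spec hex]
    exact Nat.find_min hex hj
  · rwa [Nat.find_spec hex]

theorem piece_zero : piece M L f 0 = 0 := by
  classical exact Nat.count_zero _

theorem piece_succ_of_isMainCut {i : ℕ} (h : IsMainCut M L f (i + 1)) :
    piece M L f (i + 1) = piece M L f i + 1 := by
  classical
  rw [piece, Nat.count_succ, if_pos h, piece]

theorem piece_succ_of_not_isMainCut {i : ℕ} (h : ¬ IsMainCut M L f (i + 1)) :
    piece M L f (i + 1) = piece M L f i := by
  classical
  rw [piece, Nat.count_succ, if_neg h, piece, add_zero]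

theorem piece_mono : Monotone (piece M L f) := by
  classical exact Nat.count_monotone _

theorem IsMainCut.piece_lt {i j : ℕ} (hj : IsMainCut M L f j) (hij : i < j) :
    piece M L f i < piece M L f j := by
  obtain ⟨j, rfl⟩ : ∃ k, j = k + 1 := ⟨j - 1, by omega⟩
  rw [piece_succ_of_isMainCut hj]
  exact Nat.lt_succ_of_le (piece_mono (by omega))

theorem IsMainCut.piece_injective {i j : ℕ} (hi : IsMainCut M L f i) (hj : IsMainCut M L f j)
    (h : piece M L f i = piece M L f j) : i = j := by
  rcases lt_trichotomy i j with hij | hij | hij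
  · exact absurd h (hj.piece_lt hij).ne
  · exact hij
  · exact absurd h (hi.piece_lt hij).ne'

/-- There are as many pieces before time `M` as there are vertices to be cut at. -/
theorem piece_add_one_eq_card [Fintype V] [DecidableEq V] (hM : 0 < M)
    (h0 : IsMainCut M L f 0) {A : Finset V}
    (hA : ∀ v, v ∈ A ↔ (M < L → v ≠ f (M + 1)) ∧ ∃ i < M, f i = v) :
    piece M L f (M - 1) + 1 = #A := by
  classical
  have h1 : piece M L f (M - 1) + 1 = Nat.count (IsMainCut M L f) M := by
    obtain ⟨n, rfl⟩ : ∃ n, M = n + 1 := ⟨M - 1, by omega⟩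
    rw [Nat.count_succ', if_pos h0]
    rfl
  have h2 : A = Finset.image f {i ∈ Finset.range M | IsMainCut M L f i} := by
    ext v
    simp only [hA, Finset.mem_image, Finset.mem_filter, Finset.mem_range]
    constructor
    · rintro ⟨hv, i, hi, rfl⟩
      obtain ⟨j, hj, hji⟩ := exists_isMainCut hi hv
      exact ⟨j, ⟨hj.1, hj⟩, hji⟩
    · rintro ⟨i, ⟨hi, hcut⟩, rfl⟩
      exact ⟨hcut.2.2, i, hi, rfl⟩
  rw [h1, Nat.count_eq_card_filter_range, h2, Finset.card_image_of_injOn]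
  intro i hi j hj hij
  simp only [Finset.coe_filter, Set.mem_ofPred_eq] at hi hj
  exact hi.2.eq hj.2 hij

theorem IsSplitCircuit.isMainCut_zero (h : G.IsSplitCircuit C M L f) : IsMainCut M L f 0 :=
  ⟨h.main_pos, by simp, fun hM => h.apply_main hM ▸ (h.adj M).ne⟩

/-- As `d ≥ 2`, each vertex is visited more than once in a period. -/
theorem IsEulerSeq.exists_eq_of_mem (h : G.IsEulerSeq C L f) [Fintype V] [DecidableRel G.Adj]
    {d : ℕ} (hd : 2 ≤ d) {v : V} (hv : G.connectedComponentMk v = C)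
    (hdeg : G.degree v = 2 * d) : ∃ i j, i < j ∧ j < L ∧ f i = v ∧ f j = v := by
  classical
  have hcard := h.card_visits hv hdeg
  obtain ⟨i, hi, j, hj, hij⟩ := Finset.one_lt_card.1 (hcard ▸ hd)
  simp only [Finset.mem_filter, Finset.mem_range] at hi hj
  rcases lt_or_gt_of_ne hij with hij | hij
  · exact ⟨i, j, hij, hj.1, hi.2, hj.2⟩
  · exact ⟨j, i, hij, hi.1, hj.2, hi.2⟩

theorem IsEulerSeq.isSplitCircuit_of_even [Fintype V] [DecidableRel G.Adj] {d : ℕ} (hd : 2 ≤ d)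
    (hG : G.IsRegularOfDegree (2 * d)) (h : G.IsEulerSeq C L f) (hC : Even C.supp.ncard) :
    G.IsSplitCircuit C L L f := by
  classical
  have hvisit : ∀ v, G.connectedComponentMk v = C → ∃ i < L, f i = v := fun v hv =>
    let ⟨i, j, hij, hj, hi, _⟩ := h.exists_eq_of_mem hd hv (hG v)
    ⟨i, hij.trans hj, hi⟩
  refine ⟨h, h.pos, le_rfl, by simp, by simp, hvisit, ?_⟩
  have := piece_add_one_eq_card (M := L) (L := L) (f := f) (A := C.supp.toFinset) h.pos
    ⟨h.pos, by simp, by simp⟩ (by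
      intro v
      simp only [Set.mem_toFinset, ConnectedComponent.mem_supp_iff, lt_irrefl, false_imp_iff,
        true_and]
      exact ⟨hvisit v, by rintro ⟨i, -, rfl⟩; exact h.mem i⟩)
  rw [Set.ncard_eq_toFinset_card'] at hC
  rw [← this] at hC
  exact (Nat.even_add_one.1 hC |> Nat.not_even_iff_odd.1)

/-- In an odd component, take a shortest closed part of the circuit, from `f i` to `f j`, and let the
period begin with `f j`; the vertices of the closed part are distinct, so each of them is visited in
the main part as well. -/
theorem IsEulerSeq.exists_isSplitCircuit_of_odd [Fintype V] [DecidableRel G.Adj] {d : ℕ}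
    (hd : 2 ≤ d) (hG : G.IsRegularOfDegree (2 * d)) (h : G.IsEulerSeq C L f)
    (hC : Odd C.supp.ncard) : ∃ M g, G.IsSplitCircuit C M L g := by
  classical
  have hex : ∃ j, ∃ i < j, f i = f j := ⟨L, 0, h.pos, by simpa using (h.periodic 0).symm⟩
  obtain ⟨j, ⟨i, hij, hfij⟩, hmin⟩ : ∃ j, (∃ i < j, f i = f j) ∧
      ∀ a b, a < b → b < j → f a ≠ f b :=
    ⟨Nat.find hex, Nat.find_spec hex, fun a b hab hb heq => Nat.find_min hex hb ⟨a, hab, heq⟩⟩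
  have hjL : j < L := by
    obtain ⟨a, b, hab, hb, ha, hb'⟩ := h.exists_eq_of_mem hd (h.mem 0) (hG _)
    by_contra hjL
    exact hmin a b hab (by omega) (ha.trans hb'.symm)
  -- The graph has no loops, and the circuit does not traverse an edge back and forth.
  have h3 : i + 3 ≤ j := by
    have h1 : j ≠ i + 1 := by
      rintro rfl
      exact (h.adj i).ne hfij
    have h2 : j ≠ i + 2 := by
      rintro rfl
      have := h.inj i (i + 1) (by rw [← hfij, Sym2.eq_swap])
      have hL1 : L ∣ 1 := by simpa using (Nat.modEq_iff_dvd' (Nat.le_succ i)).1 this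
      have := Nat.le_of_dvd one_pos hL1
      omega
    omega
  have hg := h.shift j
  set g : ℕ → V := fun k => f (k + j) with hgdef
  have hgper : ∀ k, g (L - (j - i) + k) = f (i + k) := by
    intro k
    have : L - (j - i) + k + j = i + k + L := by omega
    simp only [hgdef]
    rw [this, h.periodic]
  have hvisit : ∀ v, G.connectedComponentMk v = C → ∃ k < L - (j - i), g k = v := by
    intro v hv
    obtain ⟨a, b, hab, hb, ha, hb'⟩ := hg.exists_eq_of_mem hd hv (hG v)
    refine ⟨a, ?_, ha⟩
    by_contra hlt
    obtain ⟨a', rfl⟩ := Nat.exists_eq_add_of_le (not_lt.1 hlt)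
    obtain ⟨b', rfl⟩ := Nat.exists_eq_add_of_le ((not_lt.1 hlt).trans hab.le)
    rw [hgper] at ha hb'
    exact hmin (i + a') (i + b') (by omega) (by omega) (ha.trans hb'.symm)
  have hmain : g (L - (j - i)) = g 0 := by
    have := hgper 0
    simp only [add_zero] at this
    rw [this, hfij]
    simp [hgdef]
  have h0 : IsMainCut (L - (j - i)) L g 0 :=
    ⟨by omega, by simp, fun _ => hmain ▸ (hg.adj (L - (j - i))).ne⟩
  refine ⟨L - (j - i), g, hg, by omega, by omega, fun _ => hmain, fun _ => by omega,
    hvisit, ?_⟩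
  have hw : g (L - (j - i) + 1) ∈ C.supp.toFinset := by simpa using hg.mem _
  have hcard := piece_add_one_eq_card (A := C.supp.toFinset.erase (g (L - (j - i) + 1)))
    (by omega) h0 (by
      intro v
      have hlt : L - (j - i) < L := by omega
      simp only [Finset.mem_erase, Set.mem_toFinset, ConnectedComponent.mem_supp_iff, hlt,
        true_imp_iff]
      refine and_congr_right fun _ => ⟨hvisit v, ?_⟩
      rintro ⟨k, -, rfl⟩
      exact hg.mem k)
  rw [Finset.card_erase_of_mem hw] at hcard
  rw [Set.ncard_eq_toFinset_card'] at hC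
  have hpos : 0 < #C.supp.toFinset := Finset.card_pos.2 ⟨_, hw⟩
  obtain ⟨m, hm⟩ := hC
  exact ⟨m - 1, by omega⟩

theorem exists_isSplitCircuit [Fintype V] [DecidableRel G.Adj] {d : ℕ} (hd : 2 ≤ d)
    (hG : G.IsRegularOfDegree (2 * d)) (C : G.ConnectedComponent) :
    ∃ M L f, G.IsSplitCircuit C M L f := by
  obtain ⟨L, f, h⟩ := G.exists_isEulerSeq (fun v => hG v ▸ even_two_mul d)
    (fun v => by rw [hG v]; omega) C
  rcases Nat.even_or_odd C.supp.ncard with hC | hC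
  · exact ⟨L, L, f, h.isSplitCircuit_of_even hd hG hC⟩
  · obtain ⟨M, g, hg⟩ := h.exists_isSplitCircuit_of_odd hd hG hC
    exact ⟨M, L, g, hg⟩

end SimpleGraph

/-! ### Directing the pieces, and the vertex-sums -/

namespace SimpleGraph

variable {V : Type*} {G : SimpleGraph V} {C : G.ConnectedComponent} {M L : ℕ} {f : ℕ → V}

/-- The `i`-th edge is directed along the circuit (and not against it). The pieces of the main part
alternate. In the second closed part the first piece is the single edge at time `M`, directed
against the circuit, and the other piece is directed along it. -/
def IsForward (M L : ℕ) (f : ℕ → V) (i : ℕ) : Prop :=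
  if i < M then Odd (piece M L f i) else M < i

open scoped Classical in
/-- The beginning of the `i`-th edge in the direction chosen for it. -/
noncomputable def arcSrc (M L : ℕ) (f : ℕ → V) (i : ℕ) : V :=
  if IsForward M L f i then f i else f (i + 1)

open scoped Classical in
/-- The end of the `i`-th edge in the direction chosen for it. -/
noncomputable def arcDst (M L : ℕ) (f : ℕ → V) (i : ℕ) : V :=
  if IsForward M L f i then f (i + 1) else f i

open scoped Classical in
/-- What the label of the `i`-th edge contributes to the vertex-sum of `f (i + 1)`, which is minus
what it contributes to that of `f i`. -/
noncomputable def signedLabel (M L : ℕ) (f : ℕ → V) (lab : ℕ → ℕ) (i : ℕ) : ℤ :=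
  if IsForward M L f i then lab i else -lab i

/-- The labels increase by one along every pair of edges that are consecutive in a piece. -/
def IsConsecutive (M L : ℕ) (f : ℕ → V) (lab : ℕ → ℕ) : Prop :=
  ∀ i, i + 1 < L → (i + 1 < M ∧ ¬ IsMainCut M L f (i + 1) ∨ M < i) →
    signedLabel M L f lab i - signedLabel M L f lab (i + 1) = -1

/-- The time of the edge that precedes the `i`-th one when the circuit is restricted to the times
`0, …, M - 1` and closed up. -/
def mainPred (M i : ℕ) : ℕ := if i = 0 then M - 1 else i - 1

theorem mk_arcSrc_arcDst (i : ℕ) : s(arcSrc M L f i, arcDst M L f i) = s(f i, f (i + 1)) := by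
  unfold arcSrc arcDst
  split_ifs
  · rfl
  · exact Sym2.eq_swap

theorem IsEulerSeq.sum_arc_eq [DecidableEq V] (h : G.IsEulerSeq C L f) (lab : ℕ → ℕ) (u : V) :
    (∑ i ∈ Finset.range L with arcDst M L f i = u, (lab i : ℤ)) -
      ∑ i ∈ Finset.range L with arcSrc M L f i = u, (lab i : ℤ) =
    ∑ i ∈ Finset.range L with f i = u,
      (signedLabel M L f lab (mainPred L i) - signedLabel M L f lab i) := by
  rw [Finset.sum_sub_distrib]
  have := h.sum_shift (· = u) (signedLabel M L f lab)
  simp only [mainPred]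
  rw [← this]
  simp only [Finset.sum_filter, ← Finset.sum_sub_distrib]
  refine Finset.sum_congr rfl fun i _ => ?_
  unfold arcSrc arcDst signedLabel
  split_ifs <;> simp

namespace IsSplitCircuit

variable {lab : ℕ → ℕ}

/-- At a visit where the circuit is not cut, the two labels contribute `-1`; hence only the visits
where it is cut matter, once `-1` has been counted for each of the `d` visits. -/
theorem sum_arc_eq [Fintype V] [DecidableEq V] [DecidableRel G.Adj]
    (h : G.IsSplitCircuit C M L f) {d : ℕ} {u : V} (hu : G.connectedComponentMk u = C)
    (hd : G.degree u = 2 * d) :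
    (∑ i ∈ Finset.range L with arcDst M L f i = u, (lab i : ℤ)) -
      ∑ i ∈ Finset.range L with arcSrc M L f i = u, (lab i : ℤ) =
    -d + ∑ i ∈ Finset.range L with f i = u,
      (signedLabel M L f lab (mainPred L i) - signedLabel M L f lab i + 1) := by
  rw [h.toIsEulerSeq.sum_arc_eq, Finset.sum_add_distrib, Finset.sum_const,
    h.toIsEulerSeq.card_visits hu hd]
  simp

theorem gain_eq_zero (h : G.IsSplitCircuit C M L f) (hlab : IsConsecutive M L f lab) {i : ℕ}
    (hi : i < L) (hcut : ¬ IsMainCut M L f i) (hM : i ≠ M) (hM1 : i ≠ M + 1) :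
    signedLabel M L f lab (mainPred L i) - signedLabel M L f lab i + 1 = 0 := by
  have hi0 : i ≠ 0 := fun hi0 => hcut (hi0 ▸ h.isMainCut_zero)
  obtain ⟨k, rfl⟩ : ∃ k, i = k + 1 := ⟨i - 1, by omega⟩
  have := hlab k hi (by
    rcases lt_or_gt_of_ne hM with h1 | h1
    · exact Or.inl ⟨h1, hcut⟩
    · exact Or.inr (by omega))
  simp only [mainPred, if_neg hi0, Nat.add_sub_cancel]
  omega

theorem isForward_main {i : ℕ} (hi : i < M) : IsForward M L f i ↔ Odd (piece M L f i) := by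
  rw [IsForward, if_pos hi]

theorem isForward_of_lt {i : ℕ} (hi : M < i) : IsForward M L f i := by
  rw [IsForward, if_neg (by omega)]
  exact hi

theorem not_isForward_self : ¬ IsForward M L f M := by
  simp [IsForward]

/-- Where the circuit is cut, both edges are directed away from the vertex or both towards it. -/
theorem gain_of_isMainCut (h : G.IsSplitCircuit C M L f) {i : ℕ} (hi : IsMainCut M L f i) :
    signedLabel M L f lab (mainPred M i) - signedLabel M L f lab i =
      if Odd (piece M L f i) then -(lab (mainPred M i) + lab i : ℤ)
      else lab (mainPred M i) + lab i := by
  have h1 : IsForward M L f (mainPred M i) ↔ ¬ Odd (piece M L f i) := by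
    have := h.main_pos
    have := hi.1
    rcases Nat.eq_zero_or_pos i with rfl | hi0
    · simp only [mainPred, if_true, piece_zero]
      rw [isForward_main (by omega)]
      simp [h.odd_piece]
    · obtain ⟨k, rfl⟩ : ∃ k, i = k + 1 := ⟨i - 1, by omega⟩
      simp only [mainPred, if_neg hi0.ne', Nat.add_sub_cancel]
      rw [isForward_main (by omega), piece_succ_of_isMainCut hi, Nat.odd_add_one, not_not]
  unfold signedLabel
  simp only [h1, isForward_main hi.1]
  split_ifs <;> ring

/-- The vertex-sum of the vertex at which the second closed part is cut. -/
theorem sum_arc_bigon [Fintype V] [DecidableEq V] [DecidableRel G.Adj]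
    (h : G.IsSplitCircuit C M L f) (hlab : IsConsecutive M L f lab) {d : ℕ} (hML : M < L)
    (hd : G.degree (f (M + 1)) = 2 * d) :
    (∑ i ∈ Finset.range L with arcDst M L f i = f (M + 1), (lab i : ℤ)) -
      ∑ i ∈ Finset.range L with arcSrc M L f i = f (M + 1), (lab i : ℤ) =
    -d + 1 - (lab M + lab (M + 1)) := by
  rw [h.sum_arc_eq (h.mem _) hd, Finset.sum_eq_single_of_mem (M + 1)]
  · have h1 : mainPred L (M + 1) = M := by simp [mainPred]
    have h2 : signedLabel M L f lab M = -lab M := if_neg not_isForward_self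
    have h3 : signedLabel M L f lab (M + 1) = lab (M + 1) :=
      if_pos (isForward_of_lt (Nat.lt_succ_self M))
    rw [h1, h2, h3]
    ring
  · simpa using h.lt_of_lt hML
  · intro i hi hne
    simp only [Finset.mem_filter, Finset.mem_range] at hi
    refine h.gain_eq_zero hlab hi.1 (fun hcut => hcut.2.2 hML hi.2) ?_ hne
    rintro rfl
    exact (h.adj i).ne hi.2

/-- The vertex-sum of a vertex at which the main part is cut. For `M < L` the vertex `f 0 = f M` is
cut at time `M` too, which adds two further labels. -/
theorem sum_arc_isMainCut [Fintype V] [DecidableEq V] [DecidableRel G.Adj]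
    (h : G.IsSplitCircuit C M L f) (hlab : IsConsecutive M L f lab) {d : ℕ} {i : ℕ}
    (hi : IsMainCut M L f i) (hd : G.degree (f i) = 2 * d) :
    (∑ j ∈ Finset.range L with arcDst M L f j = f i, (lab j : ℤ)) -
      ∑ j ∈ Finset.range L with arcSrc M L f j = f i, (lab j : ℤ) =
    -d + 1 + (if Odd (piece M L f i) then -(lab (mainPred M i) + lab i : ℤ)
      else lab (mainPred M i) + lab i) +
      if M < L ∧ i = 0 then (1 + lab (L - 1) + lab M : ℤ) else 0 := by
  have hiL : i < L := hi.1.trans_le h.main_le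
  have hML1 := h.lt_of_lt
  rw [h.sum_arc_eq (h.mem _) hd, ← h.gain_of_isMainCut hi]
  have hzero : ∀ j, j < L → f j = f i → j ≠ i → j ≠ M →
      signedLabel M L f lab (mainPred L j) - signedLabel M L f lab j + 1 = 0 := by
    intro j hj hji hne hM
    refine h.gain_eq_zero hlab hj (fun hcut => hne (hcut.eq hi hji)) hM ?_
    rintro rfl
    exact hi.2.2 (by omega) hji.symm
  by_cases hspecial : M < L ∧ i = 0
  · obtain ⟨hML, rfl⟩ := hspecial
    have hMpos := h.main_pos
    rw [← Finset.sum_subset (s₁ := {0, M})]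
    · rw [Finset.sum_pair hMpos.ne]
      have h1 : IsForward M L f (L - 1) := isForward_of_lt (by have := hML1 hML; omega)
      simp only [mainPred, if_true, if_neg hMpos.ne', hML, true_and]
      have h2 : signedLabel M L f lab (L - 1) = lab (L - 1) := if_pos h1
      have h3 : signedLabel M L f lab M = -lab M := if_neg not_isForward_self
      rw [h2, h3]
      ring
    · intro j hj
      simp only [Finset.mem_insert, Finset.mem_singleton] at hj
      simp only [Finset.mem_filter, Finset.mem_range]
      rcases hj with rfl | rfl
      · exact ⟨hiL, rfl⟩
      · exact ⟨hML, h.apply_main hML⟩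
    · intro j hj hj'
      simp only [Finset.mem_insert, Finset.mem_singleton, not_or] at hj'
      simp only [Finset.mem_filter, Finset.mem_range] at hj
      exact hzero j hj.1 hj.2 hj'.1 hj'.2
  · rw [if_neg hspecial, Finset.sum_eq_single_of_mem i (by simpa using hiL)]
    · have : mainPred L i = mainPred M i := by
        unfold mainPred
        have := h.main_le
        split_ifs <;> omega
      rw [this]
      ring
    · intro j hj hne
      simp only [Finset.mem_filter, Finset.mem_range] at hj
      refine hzero j hj.1 hj.2 hne ?_
      rintro rfl
      have := h.apply_main hj.1
      exact hspecial ⟨hj.1, hi.eq h.isMainCut_zero (by rw [← hj.2, this])⟩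

end IsSplitCircuit

end SimpleGraph

/-! ### The order of the edges -/

namespace SimpleGraph

/-- The zigzag order of the pieces `0, …, 2r - 1` of a closed circuit: `0, 2r - 1, 1, 2r - 2, …`. -/
def zigzag (r t : ℕ) : ℕ := if t < r then 2 * t else 2 * (2 * r - 1 - t) + 1

theorem zigzag_injective {r t t' : ℕ} (ht : t < 2 * r) (ht' : t' < 2 * r)
    (h : zigzag r t = zigzag r t') : t = t' := by
  unfold zigzag at h
  split_ifs at h <;> omega

theorem zigzag_mainPred {r t : ℕ} (ht : t < 2 * r) :
    (t = 0 ∧ zigzag r (mainPred (2 * r) t) = 1 ∧ zigzag r t = 0) ∨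
    (0 < t ∧ t < r ∧ zigzag r (mainPred (2 * r) t) = 2 * t - 2 ∧ zigzag r t = 2 * t) ∨
    (t = r ∧ zigzag r (mainPred (2 * r) t) = 2 * t - 2 ∧ zigzag r t = 2 * t - 1) ∨
    (r < t ∧ zigzag r (mainPred (2 * r) t) = 2 * (2 * r - t) + 1 ∧
      zigzag r t = 2 * (2 * r - t) - 1) := by
  unfold zigzag mainPred
  rcases Nat.eq_zero_or_pos t with rfl | h0
  · left
    rw [if_pos rfl, if_neg (show ¬ 2 * r - 1 < r by omega), if_pos (show 0 < r by omega)]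
    omega
  · rw [if_neg h0.ne']
    rcases lt_trichotomy t r with h | h | h
    · rw [if_pos (by omega), if_pos h]
      omega
    · rw [if_pos (by omega), if_neg (by omega)]
      omega
    · rw [if_neg (by omega), if_neg (by omega)]
      omega

/-- In the zigzag order, of two pairs of consecutive pieces one dominates the other, provided that
the pairs are at an even distance. -/
theorem zigzag_dominates {r t t' : ℕ} (ht : t < 2 * r) (ht' : t' < 2 * r) (hne : t ≠ t')
    (hpar : Odd t ↔ Odd t') {a b a' b' : ℕ} (ha : a = zigzag r (mainPred (2 * r) t))
    (hb : b = zigzag r t) (ha' : a' = zigzag r (mainPred (2 * r) t')) (hb' : b' = zigzag r t') :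
    (a < a' ∧ b < b' ∨ a < b' ∧ b < a') ∨ (a' < a ∧ b' < b ∨ b' < a ∧ a' < b) := by
  rw [Nat.odd_iff, Nat.odd_iff] at hpar
  have h1 := zigzag_mainPred ht
  have h2 := zigzag_mainPred ht'
  rw [← ha, ← hb] at h1
  rw [← ha', ← hb'] at h2
  clear ha hb ha' hb'
  rcases h1 with h1 | h1 | h1 | h1 <;> rcases h2 with h2 | h2 | h2 | h2 <;> omega

variable {V : Type*} {G : SimpleGraph V} {C : G.ConnectedComponent} {M L : ℕ} {f : ℕ → V}

open scoped Classical in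
/-- The key by which the edges are sorted, for a circuit that is the `n`-th among `N` ones: first
come the main parts, circuit by circuit and each with its pieces in zigzag order, then the second
closed parts. Here `(piece M L f (M - 1) + 1) / 2` is half the number of pieces of the main part. -/
noncomputable def edgeKey (N n M L : ℕ) (f : ℕ → V) (i : ℕ) : ℕ ×ₗ ℕ ×ₗ ℤ :=
  toLex (if i < M then n else N + n,
    toLex (if i < M then zigzag ((piece M L f (M - 1) + 1) / 2) (piece M L f i)
      else if i = M then 0 else 1,
      if IsForward M L f i then (i : ℤ) else -i))

theorem edgeKey_lt_of_main {N n n' M L M' L' : ℕ} {f f' : ℕ → V} {i j : ℕ} (hi : i < M)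
    (hn : n < N) (h : j < M' → n < n') :
    edgeKey N n M L f i < edgeKey N n' M' L' f' j := by
  unfold edgeKey
  refine Prod.Lex.toLex_lt_toLex.2 (Or.inl ?_)
  simp only [if_pos hi]
  split_ifs with hj
  · exact h hj
  · omega

theorem edgeKey_lt_of_not_main {N n n' M L M' L' : ℕ} {f f' : ℕ → V} {i j : ℕ} (hi : M ≤ i)
    (hj : M' ≤ j) (h : n < n') : edgeKey N n M L f i < edgeKey N n' M' L' f' j := by
  unfold edgeKey
  refine Prod.Lex.toLex_lt_toLex.2 (Or.inl ?_)
  simp only [if_neg (not_lt.2 hi), if_neg (not_lt.2 hj)]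
  omega

theorem edgeKey_lt_of_zigzag {N n M L : ℕ} {f : ℕ → V} {i j : ℕ} (hi : i < M) (hj : j < M)
    (h : zigzag ((piece M L f (M - 1) + 1) / 2) (piece M L f i) <
      zigzag ((piece M L f (M - 1) + 1) / 2) (piece M L f j)) :
    edgeKey N n M L f i < edgeKey N n M L f j := by
  unfold edgeKey
  refine Prod.Lex.toLex_lt_toLex.2 (Or.inr ⟨by simp only [if_pos hi, if_pos hj], ?_⟩)
  refine Prod.Lex.toLex_lt_toLex.2 (Or.inl ?_)
  simpa only [if_pos hi, if_pos hj] using h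

theorem IsSplitCircuit.piece_lt (h : G.IsSplitCircuit C M L f) {i : ℕ} (hi : i < M) :
    piece M L f i < 2 * ((piece M L f (M - 1) + 1) / 2) := by
  have h1 : piece M L f i ≤ piece M L f (M - 1) := piece_mono (by omega)
  obtain ⟨m, hm⟩ := h.odd_piece
  omega

theorem IsSplitCircuit.edgeKey_injective {N n n' M' L' : ℕ} {f' : ℕ → V}
    (h : G.IsSplitCircuit C M L f) {i j : ℕ} (hn : n < N) (hn' : n' < N)
    (heq : n = n' → M = M' ∧ L = L' ∧ f = f')
    (hij : edgeKey N n M L f i = edgeKey N n' M' L' f' j) : n = n' ∧ i = j := by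
  have hnn : n = n' := by
    have h1 := congrArg (fun x => (ofLex x).1) hij
    simp only [edgeKey, ofLex_toLex] at h1
    split_ifs at h1 <;> omega
  refine ⟨hnn, ?_⟩
  obtain ⟨rfl, rfl, rfl⟩ := heq hnn
  subst hnn
  simp only [edgeKey, toLex_inj, Prod.mk.injEq] at hij
  obtain ⟨h1, h2, h3⟩ := hij
  by_cases hi : i < M <;> by_cases hj : j < M
  · simp only [if_pos hi, if_pos hj] at h2
    have hp := zigzag_injective (h.piece_lt hi) (h.piece_lt hj) h2
    simp only [IsForward, if_pos hi, if_pos hj, hp] at h3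
    split_ifs at h3 <;> omega
  · simp only [if_pos hi, if_neg hj] at h1
    omega
  · simp only [if_neg hi, if_pos hj] at h1
    omega
  · simp only [if_neg hi, if_neg hj] at h2
    have hfw : ∀ k, M < k → IsForward M L f k := fun k hk => IsSplitCircuit.isForward_of_lt hk
    by_cases hi' : i = M <;> by_cases hj' : j = M
    · omega
    · simp [hi', hj'] at h2
    · simp [hi', hj'] at h2
    · rw [if_pos (hfw i (by omega)), if_pos (hfw j (by omega))] at h3
      omega

/-- Two edges that are consecutive in a piece have keys with no other key in between. -/
theorem edgeKey_succ {N n i : ℕ} (h : i + 1 < M ∧ ¬ IsMainCut M L f (i + 1) ∨ M < i) :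
    ∃ a b : ℕ, ∃ c : ℤ,
      (IsForward M L f i ∧ IsForward M L f (i + 1) ∧
        edgeKey N n M L f i = toLex (a, toLex (b, c)) ∧
        edgeKey N n M L f (i + 1) = toLex (a, toLex (b, c + 1))) ∨
      (¬ IsForward M L f i ∧ ¬ IsForward M L f (i + 1) ∧
        edgeKey N n M L f i = toLex (a, toLex (b, c + 1)) ∧
        edgeKey N n M L f (i + 1) = toLex (a, toLex (b, c))) := by
  classical
  have hfw : IsForward M L f (i + 1) ↔ IsForward M L f i := by
    rcases h with ⟨h1, h2⟩ | h1
    · rw [IsSplitCircuit.isForward_main h1, IsSplitCircuit.isForward_main (by omega),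
        piece_succ_of_not_isMainCut h2]
    · exact iff_of_true (IsSplitCircuit.isForward_of_lt (by omega))
        (IsSplitCircuit.isForward_of_lt h1)
  have hkey : ∃ a b : ℕ, ∀ k, k = i ∨ k = i + 1 →
      edgeKey N n M L f k = toLex (a, toLex (b, if IsForward M L f i then (k : ℤ) else -k)) := by
    rcases h with ⟨h1, h2⟩ | h1
    · refine ⟨n, zigzag ((piece M L f (M - 1) + 1) / 2) (piece M L f i), ?_⟩
      rintro k (rfl | rfl)
      · simp only [edgeKey, if_pos (show k < M by omega)]
      · simp only [edgeKey, if_pos h1, piece_succ_of_not_isMainCut h2, hfw]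
    · refine ⟨N + n, 1, ?_⟩
      rintro k (rfl | rfl)
      · simp only [edgeKey, if_neg (show ¬ k < M by omega), if_neg (show ¬ k = M by omega)]
      · simp only [edgeKey, if_neg (show ¬ i + 1 < M by omega),
          if_neg (show ¬ i + 1 = M by omega), hfw]
  obtain ⟨a, b, hab⟩ := hkey
  by_cases hi : IsForward M L f i
  · refine ⟨a, b, i, Or.inl ⟨hi, hfw.2 hi, ?_, ?_⟩⟩
    · rw [hab i (Or.inl rfl), if_pos hi]
    · rw [hab (i + 1) (Or.inr rfl), if_pos hi, Nat.cast_succ]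
  · refine ⟨a, b, -(i + 1), Or.inr ⟨hi, fun h' => hi (hfw.1 h'), ?_, ?_⟩⟩
    · rw [hab i (Or.inl rfl), if_neg hi]
      congr 4
      ring
    · rw [hab (i + 1) (Or.inr rfl), if_neg hi, Nat.cast_succ]

theorem not_toLex_between (a b : ℕ) (c : ℤ) (x : ℕ ×ₗ ℕ ×ₗ ℤ)
    (h : toLex (a, toLex (b, c)) < x) : ¬ x < toLex (a, toLex (b, c + 1)) := by
  obtain ⟨a', b', c'⟩ := x
  intro h'
  have h1 := Prod.Lex.toLex_lt_toLex.1 h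
  have h2 := Prod.Lex.toLex_lt_toLex.1 h'
  simp only at h1 h2
  rcases h1 with h1 | ⟨h1, h3⟩ <;> rcases h2 with h2 | ⟨h2, h4⟩
  · omega
  · omega
  · omega
  · have h3 := Prod.Lex.toLex_lt_toLex.1 h3
    have h4 := Prod.Lex.toLex_lt_toLex.1 h4
    simp only at h3 h4
    omega

theorem toLex_lt_succ (a b : ℕ) (c : ℤ) :
    (toLex (a, toLex (b, c)) : ℕ ×ₗ ℕ ×ₗ ℤ) < toLex (a, toLex (b, c + 1)) :=
  Prod.Lex.toLex_lt_toLex.2 (Or.inr ⟨rfl, Prod.Lex.toLex_lt_toLex.2 (Or.inr ⟨rfl, lt_add_one c⟩)⟩)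

theorem IsSplitCircuit.piece_mainPred (h : G.IsSplitCircuit C M L f) {i : ℕ}
    (hi : IsMainCut M L f i) :
    piece M L f (mainPred M i) =
      mainPred (2 * ((piece M L f (M - 1) + 1) / 2)) (piece M L f i) := by
  obtain ⟨m, hm⟩ := h.odd_piece
  rcases Nat.eq_zero_or_pos i with rfl | h0
  · simp only [mainPred, if_true, piece_zero]
    omega
  · obtain ⟨k, rfl⟩ : ∃ k, i = k + 1 := ⟨i - 1, by omega⟩
    simp [mainPred, piece_succ_of_isMainCut hi]

theorem IsSplitCircuit.mainPred_lt (h : G.IsSplitCircuit C M L f) {i : ℕ} (hi : i < M) :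
    mainPred M i < M := by
  have := h.main_pos
  unfold mainPred
  split_ifs <;> omega

/-- Two cuts of the same type in one circuit get different sums of labels. -/
theorem IsSplitCircuit.pair_sum_ne (h : G.IsSplitCircuit C M L f) {lab : ℕ → ℕ}
    (hlab : ∀ i j, i < M → j < M → zigzag ((piece M L f (M - 1) + 1) / 2) (piece M L f i) <
      zigzag ((piece M L f (M - 1) + 1) / 2) (piece M L f j) → lab i < lab j)
    {i j : ℕ} (hi : IsMainCut M L f i) (hj : IsMainCut M L f j) (hij : i ≠ j)
    (hpar : Odd (piece M L f i) ↔ Odd (piece M L f j)) :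
    lab (mainPred M i) + lab i ≠ lab (mainPred M j) + lab j := by
  have hdom := zigzag_dominates (h.piece_lt hi.1) (h.piece_lt hj.1)
    (fun heq => hij (hi.piece_injective hj heq)) hpar rfl rfl rfl rfl
  rw [← h.piece_mainPred hi, ← h.piece_mainPred hj] at hdom
  have hi' := h.mainPred_lt hi.1
  have hj' := h.mainPred_lt hj.1
  rcases hdom with (⟨h1, h2⟩ | ⟨h1, h2⟩) | (⟨h1, h2⟩ | ⟨h1, h2⟩)
  · have h3 := hlab _ _ hi' hj' h1
    have h4 := hlab _ _ hi.1 hj.1 h2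
    omega
  · have h3 := hlab _ _ hi' hj.1 h1
    have h4 := hlab _ _ hi.1 hj' h2
    omega
  · have h3 := hlab _ _ hj' hi' h1
    have h4 := hlab _ _ hj.1 hi.1 h2
    omega
  · have h3 := hlab _ _ hj.1 hi' h1
    have h4 := hlab _ _ hj' hi.1 h2
    omega

end SimpleGraph

/-! ### Even regular graphs have antimagic orientations -/

namespace SimpleGraph

variable {V : Type*} {G : SimpleGraph V}

/-- Every `2d`-regular graph with `d ≥ 2` has an antimagic orientation. -/
theorem IsRegularOfDegree.hasAntimagicOrientation [Fintype V] [DecidableRel G.Adj] {d : ℕ}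
    (hd : 2 ≤ d) (hG : G.IsRegularOfDegree (2 * d)) : G.HasAntimagicOrientation := by
  classical
  choose M L f h using fun C => G.exists_isSplitCircuit hd hG C
  let N := Fintype.card G.ConnectedComponent
  let ord : G.ConnectedComponent → ℕ := fun C => (Fintype.equivFin _ C : ℕ)
  have hord : ∀ C, ord C < N := fun C => (Fintype.equivFin _ C).2
  have hord_inj : Function.Injective ord := fun C C' hCC =>
    (Fintype.equivFin _).injective (Fin.ext hCC)
  clear_value ord
  let S : Finset (Σ _ : G.ConnectedComponent, ℕ) := Finset.univ.sigma fun C => Finset.range (L C)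
  have hS : ∀ C i, ⟨C, i⟩ ∈ S ↔ i < L C := by simp [S]
  let key : (Σ _ : G.ConnectedComponent, ℕ) → ℕ ×ₗ ℕ ×ₗ ℤ := fun s =>
    edgeKey N (ord s.1) (M s.1) (L s.1) (f s.1) s.2
  have hkey : Set.InjOn key S := by
    rintro ⟨C, i⟩ - ⟨C', j⟩ - hij
    obtain ⟨h1, h2⟩ := (h C).edgeKey_injective (hord C) (hord C')
      (fun h1 => by obtain rfl := hord_inj h1; exact ⟨rfl, rfl, rfl⟩) hij
    obtain rfl := hord_inj h1
    obtain rfl : i = j := h2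
    rfl
  let lab : G.ConnectedComponent → ℕ → ℕ := fun C i => S.rankBy key ⟨C, i⟩
  have hlt : ∀ C i C' j, j < L C' → key ⟨C, i⟩ < key ⟨C', j⟩ → lab C i < lab C' j :=
    fun C i C' j hj hk => Finset.rankBy_lt_rankBy ((hS C' j).2 hj) hk
  have hpos : ∀ C i, i < L C → 0 < lab C i := fun C i hi => Finset.rankBy_pos ((hS C i).2 hi)
  have hmain : ∀ C i C' j, i < M C → j < M C' → ord C < ord C' → lab C i < lab C' j :=
    fun C i C' j hi hj hC => hlt _ _ _ _ (hj.trans_le (h C').main_le)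
      (edgeKey_lt_of_main hi (hord C) fun _ => hC)
  have htop : ∀ C i C' j, i < M C → M C' ≤ j → j < L C' → lab C i < lab C' j :=
    fun C i C' j hi hj hj' => hlt _ _ _ _ hj'
      (edgeKey_lt_of_main hi (hord C) fun hj'' => absurd hj (not_le.2 hj''))
  have htoptop : ∀ C i C' j, M C ≤ i → M C' ≤ j → j < L C' → ord C < ord C' →
      lab C i < lab C' j :=
    fun C i C' j hi hj hj' hC => hlt _ _ _ _ hj' (edgeKey_lt_of_not_main hi hj hC)
  have hzigzag : ∀ C i j, i < M C → j < M C →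
      zigzag ((piece (M C) (L C) (f C) (M C - 1) + 1) / 2) (piece (M C) (L C) (f C) i) <
      zigzag ((piece (M C) (L C) (f C) (M C - 1) + 1) / 2) (piece (M C) (L C) (f C) j) →
      lab C i < lab C j :=
    fun C i j hi hj hz => hlt _ _ _ _ (hj.trans_le (h C).main_le) (edgeKey_lt_of_zigzag hi hj hz)
  have hcons : ∀ C, IsConsecutive (M C) (L C) (f C) (lab C) := by
    intro C i hi hcase
    obtain ⟨a, b, c, ⟨h1, h2, h3, h4⟩ | ⟨h1, h2, h3, h4⟩⟩ :=
      edgeKey_succ (N := N) (n := ord C) hcase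
    · have : lab C (i + 1) = lab C i + 1 :=
        Finset.rankBy_eq_rankBy_add_one (key := key) hkey ((hS C _).2 hi)
          (by simp only [key, h3, h4]; exact toLex_lt_succ a b c)
          (by simp only [key, h3, h4]; exact fun x => not_toLex_between a b c _)
      simp only [signedLabel, if_pos h1, if_pos h2, this]
      push_cast
      ring
    · have : lab C i = lab C (i + 1) + 1 :=
        Finset.rankBy_eq_rankBy_add_one (key := key) hkey ((hS C _).2 (by omega))
          (by simp only [key, h3, h4]; exact toLex_lt_succ a b c)
          (by simp only [key, h3, h4]; exact fun x => not_toLex_between a b c _)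
      simp only [signedLabel, if_neg h1, if_neg h2, this]
      push_cast
      ring
  let src : (Σ _ : G.ConnectedComponent, ℕ) → V := fun s => arcSrc (M s.1) (L s.1) (f s.1) s.2
  let dst : (Σ _ : G.ConnectedComponent, ℕ) → V := fun s => arcDst (M s.1) (L s.1) (f s.1) s.2
  have hedge : ∀ C i, s(src ⟨C, i⟩, dst ⟨C, i⟩) = s(f C i, f C (i + 1)) := fun C i =>
    mk_arcSrc_arcDst i
  have hcomp : ∀ C i, G.connectedComponentMk (src ⟨C, i⟩) = C ∧
      G.connectedComponentMk (dst ⟨C, i⟩) = C := by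
    intro C i
    rcases Sym2.eq_iff.1 (hedge C i) with ⟨h1, h2⟩ | ⟨h1, h2⟩ <;> rw [h1, h2] <;>
      exact ⟨(h C).mem _, (h C).mem _⟩
  refine hasAntimagicOrientation_of_enumeration (S := S) (src := src) (dst := dst)
    (lab := S.rankBy key) ?_ ?_ ?_ (Finset.bijOn_rankBy hkey) ?_
  · rintro ⟨C, i⟩ -
    rw [← mem_edgeSet, hedge]
    exact (h C).adj i
  · rintro ⟨C, i⟩ hi ⟨C', j⟩ hj hij
    have hCC : C = C' := by
      rw [← (hcomp C i).1]
      rcases Sym2.eq_iff.1 hij with ⟨h1, -⟩ | ⟨h1, -⟩ <;> rw [h1]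
      · exact (hcomp C' j).1
      · exact (hcomp C' j).2
    subst hCC
    rw [hedge, hedge] at hij
    rw [(h C).eq_of_lt ((hS _ _).1 hi) ((hS _ _).1 hj) hij]
  · intro u v huv
    obtain ⟨i, hi, he⟩ := (h (G.connectedComponentMk u)).exists_lt huv rfl
    exact ⟨⟨_, i⟩, (hS _ _).2 hi, (hedge _ i).trans he⟩
  -- Only the circuit of the component of `u` contributes to the vertex-sum of `u`.
  have hrestrict : ∀ (g : (Σ _ : G.ConnectedComponent, ℕ) → V) (u : V),
      (∀ C i, G.connectedComponentMk (g ⟨C, i⟩) = C) →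
      (∑ s ∈ S with g s = u, (S.rankBy key s : ℤ)) =
        ∑ i ∈ Finset.range (L (G.connectedComponentMk u)) with
          g ⟨G.connectedComponentMk u, i⟩ = u, (lab (G.connectedComponentMk u) i : ℤ) := by
    intro g u hg
    rw [Finset.sum_filter, Finset.sum_sigma, Finset.sum_eq_single (G.connectedComponentMk u),
      Finset.sum_filter]
    · intro C _ hC
      refine Finset.sum_eq_zero fun i _ => if_neg ?_
      rintro rfl
      exact hC (hg C i).symm
    · simp
  -- Each vertex is cut in the second closed part or in the main part of its circuit.
  have hval : ∀ u, ∃ C, ((M C < L C ∧ u = f C (M C + 1) ∧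
        (∑ s ∈ S with dst s = u, (S.rankBy key s : ℤ)) -
          ∑ s ∈ S with src s = u, (S.rankBy key s : ℤ) =
        -d + 1 - (lab C (M C) + lab C (M C + 1))) ∨
      ∃ i, IsMainCut (M C) (L C) (f C) i ∧ u = f C i ∧
        (∑ s ∈ S with dst s = u, (S.rankBy key s : ℤ)) -
          ∑ s ∈ S with src s = u, (S.rankBy key s : ℤ) =
        -d + 1 + (if Odd (piece (M C) (L C) (f C) i) then
            -(lab C (mainPred (M C) i) + lab C i : ℤ) else lab C (mainPred (M C) i) + lab C i) +
          if M C < L C ∧ i = 0 then (1 + lab C (L C - 1) + lab C (M C) : ℤ) else 0) := by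
    intro u
    refine ⟨G.connectedComponentMk u, ?_⟩
    rw [hrestrict dst u fun C i => (hcomp C i).2, hrestrict src u fun C i => (hcomp C i).1]
    generalize hC : G.connectedComponentMk u = C
    by_cases hw : M C < L C ∧ u = f C (M C + 1)
    · obtain ⟨hML, hw⟩ := hw
      subst hw
      exact Or.inl ⟨hML, rfl, (h C).sum_arc_bigon (hcons C) hML (hG _)⟩
    · obtain ⟨k, hk, hku⟩ := (h C).exists_visit u hC
      obtain ⟨i, hi, hik⟩ := exists_isMainCut (L := L C) (f := f C) hk
        (fun hML heq => hw ⟨hML, hku.symm.trans heq⟩)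
      obtain rfl : u = f C i := hku.symm.trans hik.symm
      exact Or.inr ⟨i, hi, rfl, (h C).sum_arc_isMainCut (hcons C) hi (hG _)⟩
  have hpred : ∀ C i, i < M C → mainPred (M C) i < M C := fun C i => (h C).mainPred_lt
  have hextra : ∀ C, M C < L C → M C < L C ∧ L C - 1 < L C ∧ M C ≤ L C - 1 ∧ M C + 1 < L C :=
    fun C hML => by have := (h C).lt_of_lt hML; omega
  have hpair_lt : ∀ C i C' i', i < M C → i' < M C' → ord C < ord C' →
      lab C (mainPred (M C) i) + lab C i < lab C' (mainPred (M C') i') + lab C' i' :=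
    fun C i C' i' hi hi' hC => add_lt_add
      (hmain _ _ _ _ (hpred C i hi) (hpred C' i' hi') hC) (hmain _ _ _ _ hi hi' hC)
  have hpair : ∀ C i C' i', IsMainCut (M C) (L C) (f C) i → IsMainCut (M C') (L C') (f C') i' →
      (Odd (piece (M C) (L C) (f C) i) ↔ Odd (piece (M C') (L C') (f C') i')) →
      lab C (mainPred (M C) i) + lab C i = lab C' (mainPred (M C') i') + lab C' i' →
      f C i = f C' i' := by
    intro C i C' i' hi hi' hpar heq
    rcases lt_trichotomy (ord C) (ord C') with hC | hC | hC
    · exact absurd heq (hpair_lt C i C' i' hi.1 hi'.1 hC).ne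
    · obtain rfl := hord_inj hC
      by_contra hne
      exact (h C).pair_sum_ne (hzigzag C) hi hi' (fun h' => hne (h' ▸ rfl)) hpar heq
    · exact absurd heq (hpair_lt C' i' C i hi'.1 hi.1 hC).ne'
  intro u u' heq
  simp only at heq
  obtain ⟨C, hu⟩ := hval u
  obtain ⟨C', hu'⟩ := hval u'
  -- The cut vertex of a second closed part has a vertex-sum below those of all vertices cut in a
  -- main part.
  have hbigon_ne : ∀ C C' i', M C < L C → IsMainCut (M C') (L C') (f C') i' →
      (-d + 1 - (lab C (M C) + lab C (M C + 1)) : ℤ) ≠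
        -d + 1 + (if Odd (piece (M C') (L C') (f C') i') then
            -(lab C' (mainPred (M C') i') + lab C' i' : ℤ)
          else lab C' (mainPred (M C') i') + lab C' i') +
          if M C' < L C' ∧ i' = 0 then (1 + lab C' (L C' - 1) + lab C' (M C') : ℤ) else 0 := by
    intro C C' i' hML hi'
    obtain ⟨-, -, -, hM1⟩ := hextra C hML
    have h1 := htop C' _ C (M C) (hpred C' i' hi'.1) le_rfl hML
    have h2 := htop C' _ C (M C + 1) hi'.1 (Nat.le_succ _) hM1
    split_ifs <;> omega
  rcases hu with ⟨hML, rfl, hu⟩ | ⟨i, hi, rfl, hu⟩ <;>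
    rcases hu' with ⟨hML', rfl, hu'⟩ | ⟨i', hi', rfl, hu'⟩ <;> rw [hu, hu'] at heq
  · have hlt' : ∀ C C', M C' < L C' → ord C < ord C' →
        lab C (M C) + lab C (M C + 1) < lab C' (M C') + lab C' (M C' + 1) :=
      fun C C' hML hC => add_lt_add (htoptop _ _ _ _ le_rfl le_rfl hML hC)
        (htoptop _ _ _ _ (Nat.le_succ _) (Nat.le_succ _) (hextra C' hML).2.2.2 hC)
    rcases lt_trichotomy (ord C) (ord C') with hC | hC | hC
    · have := hlt' C C' hML' hC
      omega
    · rw [hord_inj hC]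
    · have := hlt' C' C hML hC
      omega
  · exact absurd heq (hbigon_ne C C' i' hML hi')
  · exact absurd heq.symm (hbigon_ne C' C i hML' hi)
  · have hzero : ∀ C i, Odd (piece (M C) (L C) (f C) i) → i ≠ 0 := by
      rintro C i hodd rfl
      rw [piece_zero] at hodd
      exact absurd hodd (by decide)
    have hpos' := fun C i (hi : IsMainCut (M C) (L C) (f C) i) =>
      hpos C i (hi.1.trans_le (h C).main_le)
    -- The two labels from a second closed part outweigh any two labels from main parts.
    have hbig : ∀ C C' i', M C < L C → IsMainCut (M C') (L C') (f C') i' →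
        lab C' (mainPred (M C') i') + lab C' i' < lab C (L C - 1) + lab C (M C) := by
      intro C C' i' hML hi'
      obtain ⟨-, h1, h2, -⟩ := hextra C hML
      exact add_lt_add (htop _ _ _ _ (hpred _ _ hi'.1) h2 h1) (htop _ _ _ _ hi'.1 le_rfl hML)
    by_cases hodd : Odd (piece (M C) (L C) (f C) i) <;>
      by_cases hodd' : Odd (piece (M C') (L C') (f C') i')
    · rw [if_pos hodd, if_pos hodd',
        if_neg (show ¬ (M C < L C ∧ i = 0) from fun h' => hzero C i hodd h'.2),
        if_neg (show ¬ (M C' < L C' ∧ i' = 0) from fun h' => hzero C' i' hodd' h'.2)] at heq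
      exact hpair C i C' i' hi hi' (iff_of_true hodd hodd') (by omega)
    · rw [if_pos hodd, if_neg hodd',
        if_neg (show ¬ (M C < L C ∧ i = 0) from fun h' => hzero C i hodd h'.2)] at heq
      have := hpos' C i hi
      split_ifs at heq <;> omega
    · rw [if_neg hodd, if_pos hodd',
        if_neg (show ¬ (M C' < L C' ∧ i' = 0) from fun h' => hzero C' i' hodd' h'.2)] at heq
      have := hpos' C i hi
      split_ifs at heq <;> omega
    · rw [if_neg hodd, if_neg hodd'] at heq
      by_cases hsp : M C < L C ∧ i = 0 <;> by_cases hsp' : M C' < L C' ∧ i' = 0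
      · rw [if_pos hsp, if_pos hsp'] at heq
        obtain ⟨hML, rfl⟩ := hsp
        obtain ⟨hML', rfl⟩ := hsp'
        have hlt' : ∀ C C', M C < L C → M C' < L C' → ord C < ord C' →
            lab C (L C - 1) + lab C (M C) < lab C' (L C' - 1) + lab C' (M C') := by
          intro C C' hML hML' hC
          obtain ⟨-, h1, h2, -⟩ := hextra C hML
          obtain ⟨-, h1', h2', -⟩ := hextra C' hML'
          exact add_lt_add (htoptop _ _ _ _ h2 h2' h1' hC)
            (htoptop _ _ _ _ le_rfl le_rfl hML' hC)
        rcases lt_trichotomy (ord C) (ord C') with hC | hC | hC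
        · have h1 := hpair_lt C 0 C' 0 hi.1 hi'.1 hC
          have h2 := hlt' C C' hML hML' hC
          omega
        · rw [hord_inj hC]
        · have h1 := hpair_lt C' 0 C 0 hi'.1 hi.1 hC
          have h2 := hlt' C' C hML' hML hC
          omega
      · rw [if_pos hsp, if_neg hsp'] at heq
        have := hbig C C' i' hsp.1 hi'
        omega
      · rw [if_neg hsp, if_pos hsp'] at heq
        have := hbig C' C i hsp'.1 hi
        omega
      · rw [if_neg hsp, if_neg hsp'] at heq
        exact hpair C i C' i' hi hi' (iff_of_false hodd hodd') (by omega)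

end SimpleGraph

/-! ### The order parameter -/

/-- The intervals `(2d - 2) x + {3d + 7, …, 5d + 4}` have `2d - 2` elements each and so tile the
integers from `3d + 7` on; `k` lies beyond the first of them. -/
theorem existsUnique_isOrderParameter {d k : ℕ} (hd : 2 ≤ d) (hk : 5 * d + 5 ≤ k) :
    ∃! x : ℕ, IsOrderParameter d k x := by
  obtain ⟨e, rfl⟩ : ∃ e, d = e + 1 := ⟨d - 1, by omega⟩
  have he : 2 * (e + 1) - 2 = 2 * e := by omega
  have hdiv := Nat.div_add_mod (k - (3 * e + 10)) (2 * e)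
  have hmod := Nat.mod_lt (k - (3 * e + 10)) (show 0 < 2 * e by omega)
  refine ⟨(k - (3 * e + 10)) / (2 * e), ⟨Nat.div_pos (by omega) (by omega),
    3 * e + 10 + (k - (3 * e + 10)) % (2 * e), ?_, ?_⟩, ?_⟩
  · rw [Finset.mem_Icc]
    omega
  · rw [he]
    omega
  · rintro x ⟨-, c, hc, hkx⟩
    rw [Finset.mem_Icc] at hc
    rw [he] at hkx
    symm
    rw [Nat.div_eq_iff (by omega)]
    rw [mul_comm] at hkx
    constructor <;> omega

theorem theorem1 {V : Type*} [Fintype V] (G : SimpleGraph V) [DecidableRel G.Adj] (d k : ℕ)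
    (hd : 2 ≤ d) (hG : G.IsRegularOfDegree (2 * d)) (hk : G.oddComponents.ncard = k) :
    (k ≤ 5 * d + 4 → G.HasAntimagicOrientation) ∧
    (5 * d + 5 ≤ k →
      (∃! x₀ : ℕ, IsOrderParameter d k x₀) ∧
      ∀ x₀ : ℕ, IsOrderParameter d k x₀ →
        (∀ C ∈ G.oddComponents, 2 * x₀ + 5 ≤ C.supp.ncard) → G.HasAntimagicOrientation) := by
  have h := SimpleGraph.IsRegularOfDegree.hasAntimagicOrientation hd hG
  exact ⟨fun _ => h, fun hk' => ⟨existsUnique_isOrderParameter hd hk', fun _ _ _ => h⟩⟩
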